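/- Let $0<\alpha<\delta$ be real numbers and let $x_0,y_0\ge 0$ with $x_0+y_0>0$. Let $(X(t),Y(t))_{t\ge 0}$ be the continuous-time random walk in the plane started at $(X(0),Y(0))=(x_0,y_0)$ with the balanced upper-triangular navigation matrix $$A=\begin{pmatrix}\alpha & \delta-\alpha\\ 0 & \delta\end{pmatrix}.$$ That is: whenever the walk is at $(x,y)$, the waiting time until the next renewal is exponential with rate $x+y$ and, independently of the waiting time, the renewal is of type $1$ with probability $x/(x+y)$, in which case the walk jumps to $(x+\alpha,\,y+\delta-\alpha)$, and of type $2$ with probability $y/(x+y)$, in which case it jumps to $(x,\,y+\delta)$; given the present position, the waiting time and type of the next renewal do not depend on the past; between renewals the walk does not move. Let $t\ge 0$. For all real $u,v$ such that $$e^{-\delta v}-1+e^{-\delta t}>0\quad\text{and}\quad e^{-\alpha u}-e^{-\alpha v}+\bigl(e^{-\delta v}-1+e^{-\delta t}\bigr)^{\alpha/\delta}>0$$ (this holds in particular for all $(u,v)$ in a neighbourhood of $(0,0)$), the random variable $e^{uX(t)+vY(t)}$ is integrable, and the joint moment generating function is $$\mathbb E\,e^{uX(t)+vY(t)}=e^{-x_0t}\Bigl(e^{-\alpha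 u}-e^{-\alpha v}+\bigl(e^{-\delta v}-1+e^{-\delta t}\bigr)^{\alpha/\delta}\Bigr)^{-x_0/\alpha}\cdot e^{-y_0t}\bigl(e^{-\delta v}-1+e^{-\delta t}\bigr)^{-y_0/\delta}.$$ Moreover $X(t)$ and $Y(t)$ are square-integrable, and their first and second moments are $$\begin{aligned} \mathbb E X(t)&=x_0e^{\alpha t},\\ \mathbb E Y(t)&=(x_0+y_0)e^{\delta t}-x_0e^{\alpha t},\\ \mathbb E X(t)^2&=x_0(\alpha+x_0)e^{2\alpha t}-\alpha x_0e^{\alpha t},\\ \mathbb E X(t)Y(t)&=x_0(\alpha+x_0+y_0)e^{(\alpha+\delta)t}-x_0(\alpha+x_0)e^{2\alpha t},\\ \mathbb E Y(t)^2&=(x_0+y_0)(\delta+x_0+y_0)e^{2\delta t}-2x_0(\alpha+x_0+y_0)e^{(\alpha+\delta)t}-\delta(x_0+y_0)e^{\delta t}+x_0(\alpha+x_0)e^{2\alpha t}+\alpha x_0e^{\alpha t}. \end{aligned}$$ -/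

import Mathlib

open MeasureTheory ProbabilityTheory

/-- The law of the waiting time until the next renewal when the walk sits at `z`: exponential with
rate `∑ i, z i`. -/
noncomputable def waitingTimeKernel (c : ℕ) : Kernel (Fin c → ℝ) ℝ where
  toFun z := expMeasure (∑ i, z i)
  measurable' := by
    have h : Measurable (Function.uncurry fun (z : Fin c → ℝ) (x : ℝ) =>
        exponentialPDF (∑ i, z i) x) := by
      have : (Function.uncurry fun (z : Fin c → ℝ) (x : ℝ) => exponentialPDF (∑ i, z i) x)
          = fun p : (Fin c → ℝ) × ℝ => ENNReal.ofReal
            (if 0 ≤ p.2 then (∑ i, p.1 i) * Real.exp (-((∑ i, p.1 i) * p.2)) else 0) := by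
        funext p
        simp [Function.uncurry, exponentialPDF_eq]
      rw [this]
      refine ENNReal.measurable_ofReal.comp (Measurable.ite ?_ ?_ measurable_const)
      · exact measurableSet_le measurable_const measurable_snd
      · fun_prop
    exact measurable_withDensity h

/-- The law of the colour of the next renewal when the walk sits at `z`: colour `i` has
probability `z i / ∑ j, z j`. -/
noncomputable def colourKernel (c : ℕ) : Kernel (Fin c → ℝ) (Fin c) where
  toFun z := ∑ i, ENNReal.ofReal (z i / ∑ j, z j) • Measure.dirac i
  measurable' := by
    refine Measure.measurable_of_measurable_coe _ fun s _ => ?_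
    simp only [Measure.finsetSum_apply, Measure.smul_apply, smul_eq_mul]
    fun_prop

theorem exponential_mass_le_one (r : ℝ) : expMeasure r Set.univ ≤ 1 := by
  by_cases hr : 0 < r
  · have := isProbabilityMeasure_expMeasure hr
    exact prob_le_one
  · have h0 : exponentialPDF r = fun _ => 0 := by
      funext x
      rw [exponentialPDF_eq]
      split_ifs
      · exact ENNReal.ofReal_eq_zero.2
          (mul_nonpos_of_nonpos_of_nonneg (not_lt.1 hr) (Real.exp_pos _).le)
      · simp
    change (volume.withDensity (exponentialPDF r)) Set.univ ≤ 1
    rw [h0]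
    simp

instance waitingTimeKernel_isFinite (c : ℕ) : IsFiniteKernel (waitingTimeKernel c) :=
  ⟨⟨1, ENNReal.one_lt_top, fun _ => exponential_mass_le_one _⟩⟩

instance colourKernel_isSFinite (c : ℕ) : IsSFiniteKernel (colourKernel c) := by
  have hm : Measurable (Function.uncurry fun (z : Fin c → ℝ) (i : Fin c) =>
      ENNReal.ofReal (z i / ∑ j, z j)) :=
    measurable_from_prod_countable_left fun i => by
      simp only [Function.uncurry]
      fun_prop
  have h : colourKernel c = Kernel.withDensity (Kernel.const _ Measure.count)
      (fun z i => ENNReal.ofReal (z i / ∑ j, z j)) := by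
    ext z s hs
    rw [Kernel.withDensity_apply' _ hm, Kernel.const_apply, ← lintegral_indicator hs,
      lintegral_count, tsum_fintype]
    change (∑ i, ENNReal.ofReal (z i / ∑ j, z j) • Measure.dirac i : Measure (Fin c)) s = _
    simp only [Measure.finsetSum_apply, Measure.smul_apply, smul_eq_mul,
      Measure.dirac_apply' _ hs]
    refine Finset.sum_congr rfl fun i _ => ?_
    by_cases hi : i ∈ s <;> simp [hi]
  rw [h]
  exact Kernel.IsSFiniteKernel.withDensity _ fun _ _ => ENNReal.ofReal_ne_top

/-- The joint law of the waiting time and the colour of the next renewal at position `z`: they are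
independent of each other. -/
noncomputable def renewalKernel (c : ℕ) : Kernel (Fin c → ℝ) (ℝ × Fin c) :=
  waitingTimeKernel c ×ₖ colourKernel c

/-- The position reached from `x₀` after `n` renewals of colours `J 0, …, J (n - 1)`: a renewal of
colour `i` adds the `i`-th row of the navigation matrix `A`. -/
def walkPosition {c : ℕ} (A : Matrix (Fin c) (Fin c) ℝ) (x₀ : Fin c → ℝ) {n : ℕ}
    (J : Fin n → Fin c) : Fin c → ℝ :=
  x₀ + ∑ k, A (J k)

theorem measurable_walkPosition {c : ℕ} (A : Matrix (Fin c) (Fin c) ℝ) (x₀ : Fin c → ℝ) (n : ℕ) :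
    Measurable fun h : Fin n → ℝ × Fin c => walkPosition A x₀ fun k => (h k).2 := by
  have hm : Measurable fun h : Fin n → ℝ × Fin c => fun k => (h k).2 := by fun_prop
  exact (Measurable.of_discrete (f := fun J : Fin n → Fin c => walkPosition A x₀ J)).comp hm

/-- The continuous-time process `W` on `(Ω, P)` is a walk with (deterministic) navigation matrix `A`
started at `x₀`.  There are waiting times `τ 0, τ 1, …` between consecutive renewals and colours
`J 0, J 1, …` of the renewals such that, given the first `n` waiting times and colours, the next
waiting time is exponential with rate the coordinate sum of the current position, and, independently
of it, the next colour is chosen with probability proportional to the coordinates of the current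
position; and from the `n`-th renewal up to the next one, `W` stays at the position reached after
`n` renewals. -/
def IsContinuumPolyaWalk {c : ℕ} {Ω : Type*} [MeasurableSpace Ω]
    (A : Matrix (Fin c) (Fin c) ℝ) (x₀ : Fin c → ℝ) (W : ℝ → Ω → Fin c → ℝ) (P : Measure Ω) :
    Prop :=
  ∃ (τ : ℕ → Ω → ℝ) (J : ℕ → Ω → Fin c),
    (∀ n, HasCondDistrib (fun ω => (τ n ω, J n ω)) (fun ω (k : Fin n) => (τ k ω, J k ω))
      ((renewalKernel c).comap (fun h => walkPosition A x₀ fun k => (h k).2)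
        (measurable_walkPosition A x₀ n)) P) ∧
    ∀ᵐ ω ∂P, ∀ (n : ℕ) (t : ℝ),
      ∑ k ∈ Finset.range n, τ k ω ≤ t → t < ∑ k ∈ Finset.range (n + 1), τ k ω →
        W t ω = walkPosition A x₀ fun k : Fin n => J k ω

/-!
The logarithm of the Laplace transform of the walk is linear in the starting point, so a function
`g` with `gᵢ' = exp ((A g)ᵢ) - 1` should satisfy `𝔼 exp (g 0 ⬝ᵥ W t) = exp (g t ⬝ᵥ x₀)`.  Indeed the
value `exp (g (t - Tₙ) ⬝ᵥ Zₙ)` at the `n`-th renewal (time `Tₙ`, position `Zₙ`) satisfies the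
renewal equation, and iterating it leaves only a remainder term carried by the event `Tₙ ≤ t`.  If a
second solution lies above `g + ε`, this remainder is at most a constant times
`exp (-ε ∑ᵢ (Zₙ)ᵢ)`, which decreases geometrically because each renewal adds a fixed amount to the
coordinate sum.  The case `g = 0` says that the walk does not explode.  For the triangular matrix
the characteristic equation is solved explicitly by the logarithms of the two brackets, and shifting
`(u, v)` to `(u + ε, v + ε)` gives the second solution.  The moments are read off from the first two
derivatives at `0` of the cumulant generating functions of `i X + j Y`.
-/

open scoped Matrix

theorem log_add_le_of_le_exp_mul {a b r ε : ℝ} (ha : 0 < a) (hb : 0 < b) (hr : 0 < r)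
    (hab : b ≤ Real.exp (-r * ε) * a) : -Real.log a / r + ε ≤ -Real.log b / r := by
  have hlog := Real.log_le_log hb hab
  rw [Real.log_mul (Real.exp_pos _).ne' ha.ne', Real.log_exp] at hlog
  rw [← le_sub_iff_add_le', div_sub_div_same, le_div_iff₀ hr]
  linarith

theorem hasDerivAt_exp_mul_mul (a b θ : ℝ) :
    HasDerivAt (fun θ => Real.exp (a * (b * θ))) (a * b * Real.exp (a * (b * θ))) θ := by
  refine (((hasDerivAt_id θ).const_mul b).const_mul a).exp.congr_deriv ?_
  simp only [id_eq]
  ring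

theorem ofReal_add_lintegral_Ioc_of_hasDerivAt_neg {f f' : ℝ → ℝ} {a b : ℝ} (hab : a ≤ b)
    (hf : ∀ x ∈ Set.Icc a b, HasDerivAt f (-f' x) x) (hf' : ∀ x ∈ Set.Icc a b, 0 ≤ f' x)
    (hb : 0 ≤ f b) :
    ENNReal.ofReal (f b) + ∫⁻ x in Set.Ioc a b, ENNReal.ofReal (f' x) = ENNReal.ofReal (f a) := by
  have hderiv : ∀ x ∈ Set.Icc a b, HasDerivAt (-f) (f' x) x := fun x hx => by
    simpa using (hf x hx).neg
  have hint : IntegrableOn f' (Set.Ioc a b) :=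
    intervalIntegral.integrableOn_deriv_of_nonneg
      (fun x hx => (hderiv x hx).continuousAt.continuousWithinAt)
      (fun x hx => hderiv x (Set.Ioo_subset_Icc_self hx))
      fun x hx => hf' x (Set.Ioo_subset_Icc_self hx)
  have hnonneg : 0 ≤ᵐ[volume.restrict (Set.Ioc a b)] f' :=
    (ae_restrict_mem measurableSet_Ioc).mono fun x hx => hf' x (Set.Ioc_subset_Icc_self hx)
  rw [← ofReal_integral_eq_lintegral_ofReal hint hnonneg,
    ← ENNReal.ofReal_add hb (integral_nonneg_of_ae hnonneg), ← intervalIntegral.integral_of_le hab,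
    intervalIntegral.integral_eq_sub_of_hasDerivAt (by rwa [Set.uIcc_of_le hab])
      ((intervalIntegrable_iff_integrableOn_Ioc_of_le hab).2 hint)]
  simp

theorem lintegral_Ioi_sum_ofReal_mul_exp {c : ℕ} {z : Fin c → ℝ} (hz : 0 ≤ z)
    (hz' : 0 < ∑ i, z i) (s : ℝ) :
    ∫⁻ x in Set.Ioi s, ∑ i, ENNReal.ofReal (z i * Real.exp (-(∑ j, z j) * x))
      = ENNReal.ofReal (Real.exp (-(∑ j, z j) * s)) := by
  have hint : IntegrableOn (fun x => (∑ i, z i) * Real.exp (-(∑ j, z j) * x)) (Set.Ioi s) :=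
    (integrableOn_exp_mul_Ioi (neg_neg_of_pos hz') s).const_mul _
  simp_rw [← ENNReal.ofReal_sum_of_nonneg fun i _ => mul_nonneg (hz i) (Real.exp_pos _).le,
    ← Finset.sum_mul]
  rw [← ofReal_integral_eq_lintegral_ofReal hint (ae_of_all _ fun x => by positivity),
    integral_const_mul, integral_exp_mul_Ioi (neg_neg_of_pos hz')]
  congr 1
  field_simp

theorem moments_of_hasDerivAt_cgf {Ω : Type*} [MeasurableSpace Ω] {P : Measure Ω}
    [IsProbabilityMeasure P] {Z : Ω → ℝ} {f f' : ℝ → ℝ} {κ : ℝ}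
    (hint : ∀ᶠ θ in nhds 0, Integrable (fun ω => Real.exp (θ * Z ω)) P)
    (hcgf : cgf Z P =ᶠ[nhds 0] f) (hf : ∀ᶠ θ in nhds 0, HasDerivAt f (f' θ) θ)
    (hf' : HasDerivAt f' κ 0) :
    MemLp Z 2 P ∧ ∫ ω, Z ω ∂P = f' 0 ∧ ∫ ω, Z ω ^ 2 ∂P = κ + f' 0 ^ 2 := by
  have hmem : (0 : ℝ) ∈ interior (integrableExpSet Z P) := mem_interior_iff_mem_nhds.2 hint
  have hderiv : deriv (cgf Z P) =ᶠ[nhds 0] f' :=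
    hcgf.deriv.trans (hf.mono fun θ hθ => hθ.deriv)
  have hmean := deriv_cgf_zero hmem
  have hvar := iteratedDeriv_two_cgf hmem
  rw [iteratedDeriv_succ, iteratedDeriv_one, hderiv.deriv_eq, hf'.deriv, hderiv.eq_of_nhds] at hvar
  rw [hderiv.eq_of_nhds] at hmean
  simp only [probReal_univ, div_one] at hmean
  simp only [zero_mul, Real.exp_zero, mul_one, mgf_zero, div_one] at hvar
  exact ⟨memLp_of_mem_interior_integrableExpSet hmem 2, hmean.symm, by linarith⟩

theorem integral_mul_eq_half_integral_sq_add_sub {Ω : Type*} [MeasurableSpace Ω] {P : Measure Ω}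
    {X Y : Ω → ℝ} (hX : MemLp X 2 P) (hY : MemLp Y 2 P) :
    ∫ ω, X ω * Y ω ∂P
      = (∫ ω, (X ω + Y ω) ^ 2 ∂P - ∫ ω, X ω ^ 2 ∂P - ∫ ω, Y ω ^ 2 ∂P) / 2 := by
  have hXY : MemLp (fun ω => X ω + Y ω) 2 P := hX.add hY
  have hdiff : Integrable (fun ω => (X ω + Y ω) ^ 2 - X ω ^ 2) P :=
    hXY.integrable_sq.sub hX.integrable_sq
  rw [← integral_sub hXY.integrable_sq hX.integrable_sq, ← integral_sub hdiff hY.integrable_sq,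
    ← integral_div]
  congr with ω
  ring

instance renewalKernel_isSFinite (c : ℕ) : IsSFiniteKernel (renewalKernel c) := by
  unfold renewalKernel
  infer_instance

theorem lintegral_renewalKernel {c : ℕ} {z : Fin c → ℝ} (hz : 0 < ∑ i, z i)
    {f : ℝ × Fin c → ENNReal} (hf : Measurable f) :
    ∫⁻ p, f p ∂(renewalKernel c z)
      = ∫⁻ x in Set.Ioi 0, ∑ i, ENNReal.ofReal (z i * Real.exp (-(∑ j, z j) * x)) * f (x, i) := by
  have hcolour (x : ℝ) : ∫⁻ i, f (x, i) ∂(colourKernel c z)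
      = ∑ i, ENNReal.ofReal (z i / ∑ j, z j) * f (x, i) := by
    change ∫⁻ i, f (x, i)
      ∂(∑ i, ENNReal.ofReal (z i / ∑ j, z j) • Measure.dirac i : Measure (Fin c)) = _
    simp [lintegral_finsetSum_measure]
  have hpdf : exponentialPDF (∑ j, z j) = (Set.Ici 0).indicator fun x =>
      ENNReal.ofReal ((∑ j, z j) * Real.exp (-(∑ j, z j) * x)) := by
    ext x
    by_cases hx : 0 ≤ x <;> simp [exponentialPDF_eq, hx]
  rw [renewalKernel, Kernel.prod_apply, lintegral_prod _ hf.aemeasurable]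
  simp_rw [hcolour]
  change ∫⁻ x, _ ∂(volume.withDensity (exponentialPDF (∑ j, z j))) = _
  rw [hpdf, withDensity_indicator measurableSet_Ici, ← restrict_Ioi_eq_restrict_Ici,
    lintegral_withDensity_eq_lintegral_mul _ (by fun_prop) (by fun_prop)]
  refine lintegral_congr fun x => ?_
  simp only [Pi.mul_apply, Finset.mul_sum, ← mul_assoc,
    ← ENNReal.ofReal_mul (mul_nonneg hz.le (Real.exp_pos _).le)]
  refine Finset.sum_congr rfl fun i _ => ?_
  congr 2
  field_simp

/-- The waiting times `τ` and colours `J` drive the walk with navigation matrix `A` started at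
`x₀`: this is the probabilistic half of `IsContinuumPolyaWalk`, without the process `W`. -/
def IsRenewalSequence {c : ℕ} {Ω : Type*} [MeasurableSpace Ω] (A : Matrix (Fin c) (Fin c) ℝ)
    (x₀ : Fin c → ℝ) (τ : ℕ → Ω → ℝ) (J : ℕ → Ω → Fin c) (P : Measure Ω) : Prop :=
  ∀ n, HasCondDistrib (fun ω => (τ n ω, J n ω)) (fun ω (k : Fin n) => (τ k ω, J k ω))
    ((renewalKernel c).comap (fun h => walkPosition A x₀ fun k => (h k).2)
      (measurable_walkPosition A x₀ n)) P

/-- The time of the `n`-th renewal. -/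
def renewalTime {Ω : Type*} (τ : ℕ → Ω → ℝ) (n : ℕ) (ω : Ω) : ℝ :=
  ∑ k ∈ Finset.range n, τ k ω

/-- The position of the walk after `n` renewals. -/
def renewalPosition {c : ℕ} {Ω : Type*} (A : Matrix (Fin c) (Fin c) ℝ) (x₀ : Fin c → ℝ)
    (J : ℕ → Ω → Fin c) (n : ℕ) (ω : Ω) : Fin c → ℝ :=
  walkPosition A x₀ fun k : Fin n => J k ω

/-- The navigation matrix `A` and the starting point `x₀` have nonnegative entries, every row of
`A` has a positive sum, and so has `x₀`.  The total renewal rate is then positive and increases by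
at least a fixed amount with each renewal. -/
structure IsGrowing {c : ℕ} (A : Matrix (Fin c) (Fin c) ℝ) (x₀ : Fin c → ℝ) : Prop where
  row_nonneg : ∀ i, 0 ≤ A i
  sum_row_pos : ∀ i, 0 < ∑ j, A i j
  start_nonneg : 0 ≤ x₀
  sum_start_pos : 0 < ∑ i, x₀ i

theorem IsGrowing.exists_pos_le_sum_row {c : ℕ} {A : Matrix (Fin c) (Fin c) ℝ} {x₀ : Fin c → ℝ}
    (h : IsGrowing A x₀) : ∃ δ > 0, ∀ i, δ ≤ ∑ j, A i j := by
  have hall : ∀ᶠ δ in nhdsWithin (0 : ℝ) (Set.Ioi 0), ∀ i, δ ≤ ∑ j, A i j :=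
    nhdsWithin_le_nhds (Filter.eventually_all.2 fun i => eventually_le_nhds (h.sum_row_pos i))
  exact (hall.and self_mem_nhdsWithin).exists.imp fun δ hδ => ⟨hδ.2, hδ.1⟩

section Renewal

variable {c : ℕ} {Ω : Type*} {A : Matrix (Fin c) (Fin c) ℝ} {x₀ : Fin c → ℝ}
  {τ : ℕ → Ω → ℝ} {J : ℕ → Ω → Fin c}

theorem renewalTime_zero (τ : ℕ → Ω → ℝ) (ω : Ω) : renewalTime τ 0 ω = 0 :=
  Finset.sum_range_zero _

theorem renewalTime_succ (τ : ℕ → Ω → ℝ) (n : ℕ) (ω : Ω) :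
    renewalTime τ (n + 1) ω = renewalTime τ n ω + τ n ω :=
  Finset.sum_range_succ _ _

theorem renewalPosition_zero (A : Matrix (Fin c) (Fin c) ℝ) (x₀ : Fin c → ℝ) (J : ℕ → Ω → Fin c)
    (ω : Ω) : renewalPosition A x₀ J 0 ω = x₀ := by
  simp [renewalPosition, walkPosition]

theorem renewalPosition_succ (A : Matrix (Fin c) (Fin c) ℝ) (x₀ : Fin c → ℝ) (J : ℕ → Ω → Fin c)
    (n : ℕ) (ω : Ω) :
    renewalPosition A x₀ J (n + 1) ω = renewalPosition A x₀ J n ω + A (J n ω) := by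
  simp [renewalPosition, walkPosition, Fin.sum_univ_castSucc, add_assoc]

theorem le_sum_renewalPosition {δ : ℝ} (hδ : ∀ i, δ ≤ ∑ j, A i j) (n : ℕ) (ω : Ω) :
    ∑ i, x₀ i + n * δ ≤ ∑ i, renewalPosition A x₀ J n ω i := by
  induction n with
  | zero => simp [renewalPosition_zero]
  | succ n ih =>
    simp only [renewalPosition_succ, Pi.add_apply, Finset.sum_add_distrib, Nat.cast_succ]
    linarith [hδ (J n ω)]

theorem IsGrowing.renewalPosition_nonneg (h : IsGrowing A x₀) (n : ℕ) (ω : Ω) :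
    0 ≤ renewalPosition A x₀ J n ω :=
  add_nonneg h.start_nonneg (Finset.sum_nonneg fun k _ => h.row_nonneg (J k ω))

theorem IsGrowing.sum_renewalPosition_pos (h : IsGrowing A x₀) (n : ℕ) (ω : Ω) :
    0 < ∑ i, renewalPosition A x₀ J n ω i := by
  have := le_sum_renewalPosition (x₀ := x₀) (J := J) (fun i => (h.sum_row_pos i).le) n ω
  linarith [h.sum_start_pos]

end Renewal

namespace IsRenewalSequence

variable {c : ℕ} {Ω : Type*} [MeasurableSpace Ω] {A : Matrix (Fin c) (Fin c) ℝ}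
  {x₀ : Fin c → ℝ} {τ : ℕ → Ω → ℝ} {J : ℕ → Ω → Fin c} {P : Measure Ω}

theorem aemeasurable_renewalTime (h : IsRenewalSequence A x₀ τ J P) (n : ℕ) :
    AEMeasurable (renewalTime τ n) P :=
  Finset.aemeasurable_fun_sum _ fun k _ => (h k).aemeasurable_snd.fst

theorem aemeasurable_renewalPosition (h : IsRenewalSequence A x₀ τ J P) (n : ℕ) :
    AEMeasurable (renewalPosition A x₀ J n) P :=
  (measurable_walkPosition A x₀ n).comp_aemeasurable (h n).aemeasurable_fst

theorem lintegral_next_renewal [SFinite P] (h : IsRenewalSequence A x₀ τ J P) (n : ℕ)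
    {F : (ℝ × (Fin c → ℝ)) × (ℝ × Fin c) → ENNReal} (hF : Measurable F) :
    ∫⁻ ω, F ((renewalTime τ n ω, renewalPosition A x₀ J n ω), (τ n ω, J n ω)) ∂P
      = ∫⁻ ω, ∫⁻ p, F ((renewalTime τ n ω, renewalPosition A x₀ J n ω), p)
          ∂(renewalKernel c (renewalPosition A x₀ J n ω)) ∂P := by
  let state (h : Fin n → ℝ × Fin c) : ℝ × (Fin c → ℝ) :=
    (∑ k, (h k).1, walkPosition A x₀ fun k => (h k).2)
  have hstate : Measurable state := by
    have := measurable_walkPosition A x₀ n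
    fun_prop
  have hstate_eq (ω : Ω) : state (fun k => (τ k ω, J k ω))
      = (renewalTime τ n ω, renewalPosition A x₀ J n ω) :=
    Prod.ext (Finset.sum_range fun k => τ k ω).symm rfl
  have hG : Measurable fun q : (Fin n → ℝ × Fin c) × (ℝ × Fin c) => F (state q.1, q.2) := by
    fun_prop
  simp only [← hstate_eq]
  have hlaw := (h n).map_eq
  have := lintegral_map' hG.aemeasurable (h n).aemeasurable
  rw [hlaw, Measure.lintegral_compProd hG, lintegral_map'
    hG.lintegral_kernel_prod_right'.aemeasurable (h n).aemeasurable_fst] at this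
  exact this.symm

theorem ae_waiting_pos [SFinite P] (h : IsRenewalSequence A x₀ τ J P) (hA : IsGrowing A x₀) :
    ∀ᵐ ω ∂P, ∀ n, 0 < τ n ω := by
  refine ae_all_iff.2 fun n => ?_
  have hmeas : Measurable ((Set.Iic (0 : ℝ)).indicator (1 : ℝ → ENNReal)) :=
    measurable_one.indicator measurableSet_Iic
  have hnull : ∫⁻ ω, (Set.Iic (0 : ℝ)).indicator 1 (τ n ω) ∂P = 0 := by
    rw [h.lintegral_next_renewal n (F := fun q => (Set.Iic (0 : ℝ)).indicator 1 q.2.1)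
      (by fun_prop)]
    refine (lintegral_congr fun ω => ?_).trans lintegral_zero
    rw [lintegral_renewalKernel (hA.sum_renewalPosition_pos n ω) (by fun_prop)]
    refine (setLIntegral_congr_fun measurableSet_Ioi fun x hx => ?_).trans lintegral_zero
    simp [not_le.2 (Set.mem_Ioi.1 hx)]
  filter_upwards [(lintegral_eq_zero_iff'
    (hmeas.comp_aemeasurable (h n).aemeasurable_snd.fst)).1 hnull] with ω hω
  by_contra! hle
  simp [hle] at hω

end IsRenewalSequence

/-- The function `g` solves, on `[0, t]`, the characteristic equation `gᵢ' = exp ((A g)ᵢ) - 1` of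
the walk with navigation matrix `A`.  The logarithm of the Laplace transform of the walk at time `s`
is linear in the starting point, and `g s` is its coefficient vector. -/
def IsCharacteristicFlow {c : ℕ} (A : Matrix (Fin c) (Fin c) ℝ) (t : ℝ) (g : ℝ → Fin c → ℝ) :
    Prop :=
  ∀ s ∈ Set.Icc 0 t, HasDerivAt g (fun i => Real.exp ((A *ᵥ g s) i) - 1) s

/-- The expectation of `exp (g 0 ⬝ᵥ W s)` for the walk `W` started at `z`.  It is set to `0` for
`s ∉ [0, t]`, so that renewals after time `t` contribute nothing. -/
noncomputable def flowValue {c : ℕ} (t : ℝ) (g : ℝ → Fin c → ℝ) (s : ℝ) (z : Fin c → ℝ) :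
    ENNReal :=
  (Set.Icc 0 t).indicator (fun s => ENNReal.ofReal (Real.exp (g s ⬝ᵥ z))) s

theorem flowValue_of_mem {c : ℕ} {t s : ℝ} (hs : s ∈ Set.Icc 0 t) (g : ℝ → Fin c → ℝ)
    (z : Fin c → ℝ) : flowValue t g s z = ENNReal.ofReal (Real.exp (g s ⬝ᵥ z)) :=
  Set.indicator_of_mem hs _

theorem flowValue_of_neg {c : ℕ} (t : ℝ) {s : ℝ} (hs : s < 0) (g : ℝ → Fin c → ℝ)
    (z : Fin c → ℝ) : flowValue t g s z = 0 :=
  Set.indicator_of_notMem (fun h => hs.not_ge h.1) _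

namespace IsCharacteristicFlow

variable {c : ℕ} {A : Matrix (Fin c) (Fin c) ℝ} {t : ℝ} {g : ℝ → Fin c → ℝ}

theorem measurable_flowValue (hg : IsCharacteristicFlow A t g) :
    Measurable fun p : ℝ × (Fin c → ℝ) => flowValue t g p.1 p.2 := by
  classical
  have hcont : ContinuousOn g (Set.Icc 0 t) := fun s hs =>
    (hg s hs).continuousAt.continuousWithinAt
  have := ContinuousOn.measurable_piecewise (s := Set.Icc 0 t ×ˢ (Set.univ : Set (Fin c → ℝ)))
    (f := fun p : ℝ × (Fin c → ℝ) => ENNReal.ofReal (Real.exp (g p.1 ⬝ᵥ p.2)))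
    (g := fun _ => (0 : ENNReal)) ?_ continuousOn_const (measurableSet_Icc.prod .univ)
  · convert this using 2 with p
    simp [flowValue, Set.indicator, Set.piecewise]
  · have hg' : ContinuousOn (fun p : ℝ × (Fin c → ℝ) => g p.1) (Set.Icc 0 t ×ˢ Set.univ) :=
      hcont.comp continuousOn_fst fun p hp => hp.1
    refine ENNReal.continuous_ofReal.comp_continuousOn (Real.continuous_exp.comp_continuousOn ?_)
    exact (continuous_fst.dotProduct continuous_snd).comp_continuousOn
      (hg'.prodMk continuousOn_snd)

theorem hasDerivAt_exp_mul_exp_dotProduct (hg : IsCharacteristicFlow A t g) (z : Fin c → ℝ)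
    {s x : ℝ} (hx : s - x ∈ Set.Icc 0 t) :
    HasDerivAt (fun x => Real.exp (-(∑ i, z i) * x) * Real.exp (g (s - x) ⬝ᵥ z))
      (-∑ i, z i * Real.exp (-(∑ j, z j) * x) * Real.exp (g (s - x) ⬝ᵥ (z + A i))) x := by
  have hflow : HasDerivAt (fun x => g (s - x) ⬝ᵥ z)
      (∑ i, -(Real.exp ((A *ᵥ g (s - x)) i) - 1) * z i) x := by
    refine HasDerivAt.fun_sum fun i _ => HasDerivAt.mul_const ?_ (z i)
    exact (hasDerivAt_pi.1 (hg _ hx) i).comp_const_sub s x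
  have hdecay : HasDerivAt (fun x => Real.exp (-(∑ i, z i) * x))
      (Real.exp (-(∑ i, z i) * x) * -(∑ i, z i)) x := by
    simpa using ((hasDerivAt_id x).const_mul (-(∑ i, z i))).exp
  refine (hdecay.mul hflow.exp).congr_deriv ?_
  have hexp (i : Fin c) : Real.exp (g (s - x) ⬝ᵥ (z + A i))
      = Real.exp (g (s - x) ⬝ᵥ z) * Real.exp ((A *ᵥ g (s - x)) i) := by
    rw [dotProduct_add, Real.exp_add, dotProduct_comm _ (A i)]
    rfl
  have hsum : ∑ i, z i * Real.exp (-(∑ j, z j) * x) * Real.exp (g (s - x) ⬝ᵥ (z + A i))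
      = Real.exp (-(∑ j, z j) * x) * Real.exp (g (s - x) ⬝ᵥ z)
        * ∑ i, Real.exp ((A *ᵥ g (s - x)) i) * z i := by
    rw [Finset.mul_sum]
    exact Finset.sum_congr rfl fun i _ => by rw [hexp]; ring
  simp only [hsum, neg_sub, sub_mul, one_mul, Finset.sum_sub_distrib]
  ring

theorem ofReal_add_lintegral_Ioc_flowValue (hg : IsCharacteristicFlow A t g) {z : Fin c → ℝ}
    (hz : 0 ≤ z) {s : ℝ} (hs : s ∈ Set.Icc 0 t) :
    ENNReal.ofReal (Real.exp (-(∑ j, z j) * s) * Real.exp (g 0 ⬝ᵥ z))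
        + ∫⁻ x in Set.Ioc 0 s, ∑ i, ENNReal.ofReal (z i * Real.exp (-(∑ j, z j) * x))
          * flowValue t g (s - x) (z + A i)
      = flowValue t g s z := by
  have hmem {x : ℝ} (hx : x ∈ Set.Icc 0 s) : s - x ∈ Set.Icc 0 t :=
    ⟨sub_nonneg.2 hx.2, by linarith [hx.1, hs.2]⟩
  have hterm (x : ℝ) (i : Fin c) : 0 ≤ z i * Real.exp (-(∑ j, z j) * x) :=
    mul_nonneg (hz i) (Real.exp_pos _).le
  have key := ofReal_add_lintegral_Ioc_of_hasDerivAt_neg hs.1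
    (fun x hx => hg.hasDerivAt_exp_mul_exp_dotProduct z (hmem hx))
    (fun x _ => Finset.sum_nonneg fun i _ => mul_nonneg (hterm x i) (Real.exp_pos _).le)
    (by positivity)
  simp only [sub_self, sub_zero, mul_zero, Real.exp_zero, one_mul] at key
  rw [flowValue_of_mem hs, ← key]
  congr 1
  refine setLIntegral_congr_fun measurableSet_Ioc fun x hx => ?_
  rw [ENNReal.ofReal_sum_of_nonneg fun i _ => mul_nonneg (hterm x i) (Real.exp_pos _).le]
  refine Finset.sum_congr rfl fun i _ => ?_
  rw [flowValue_of_mem (hmem (Set.Ioc_subset_Icc_self hx)), ENNReal.ofReal_mul (hterm x i)]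

theorem measurable_sojourn_add_flowValue (hg : IsCharacteristicFlow A t g) :
    Measurable fun q : (ℝ × (Fin c → ℝ)) × (ℝ × Fin c) =>
      (Set.Ico 0 q.2.1).indicator (fun _ => ENNReal.ofReal (Real.exp (g 0 ⬝ᵥ q.1.2))) q.1.1
        + flowValue t g (q.1.1 - q.2.1) (q.1.2 + A q.2.2) := by
  have hrow : Measurable fun i : Fin c => A i := .of_discrete
  have hdot : Measurable fun z : Fin c → ℝ => g 0 ⬝ᵥ z := by
    unfold dotProduct
    fun_prop
  refine Measurable.add (Measurable.ite ?_ (by fun_prop) measurable_const) ?_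
  · exact (measurableSet_le measurable_const measurable_fst.fst).inter
      (measurableSet_lt measurable_fst.fst measurable_snd.fst)
  · exact hg.measurable_flowValue.comp
      (f := fun q : (ℝ × (Fin c → ℝ)) × (ℝ × Fin c) => (q.1.1 - q.2.1, q.1.2 + A q.2.2))
      (by fun_prop)

-- The first summand is the case in which the next renewal comes later than the remaining time `s`.
theorem lintegral_renewalKernel_flowValue (hg : IsCharacteristicFlow A t g) {z : Fin c → ℝ}
    (hz : 0 ≤ z) (hz' : 0 < ∑ i, z i) {s : ℝ} (hs : s ≤ t) :
    ∫⁻ p, ((Set.Ico 0 p.1).indicator (fun _ => ENNReal.ofReal (Real.exp (g 0 ⬝ᵥ z))) s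
        + flowValue t g (s - p.1) (z + A p.2)) ∂(renewalKernel c z)
      = flowValue t g s z := by
  have hmeas := hg.measurable_sojourn_add_flowValue.comp (measurable_prodMk_left (x := (s, z)))
  refine (lintegral_renewalKernel hz' hmeas).trans ?_
  simp only [Function.comp_apply]
  rcases lt_or_ge s 0 with hneg | hnonneg
  · rw [flowValue_of_neg t hneg]
    refine (setLIntegral_congr_fun measurableSet_Ioi fun x hx => ?_).trans lintegral_zero
    have hx : 0 < x := hx
    simp [flowValue_of_neg t (show s - x < 0 by linarith), hneg.not_ge]
  rw [← Set.Ioc_union_Ioi_eq_Ioi hnonneg, lintegral_union measurableSet_Ioi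
    Set.Ioc_disjoint_Ioi_same, add_comm, ← hg.ofReal_add_lintegral_Ioc_flowValue hz ⟨hnonneg, hs⟩]
  congr 1
  · rw [ENNReal.ofReal_mul (Real.exp_pos _).le, ← lintegral_Ioi_sum_ofReal_mul_exp hz hz',
      ← lintegral_mul_const' _ _ ENNReal.ofReal_ne_top]
    refine setLIntegral_congr_fun measurableSet_Ioi fun x hx => ?_
    have hx : s < x := hx
    simp only [Set.indicator_of_mem (Set.mem_Ico.2 ⟨hnonneg, hx⟩),
      flowValue_of_neg t (sub_neg.2 hx), add_zero, Finset.sum_mul]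
  · refine setLIntegral_congr_fun measurableSet_Ioc fun x hx => ?_
    simp [hx.2]

end IsCharacteristicFlow

/-- A characteristic flow `g` on `[0, t]` with another one at a distance of at least `ε > 0` above
it.  This makes `flowValue t g` smaller than the other flow value by a factor that is exponentially
small in the coordinate sum of the position, hence in the number of renewals. -/
def IsDominatedFlow {c : ℕ} (A : Matrix (Fin c) (Fin c) ℝ) (t : ℝ) (g : ℝ → Fin c → ℝ) : Prop :=
  IsCharacteristicFlow A t g ∧ ∃ ε > 0, ∃ g' : ℝ → Fin c → ℝ, IsCharacteristicFlow A t g' ∧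
    ∀ s ∈ Set.Icc 0 t, ∀ i, g s i + ε ≤ g' s i

theorem flowValue_le_of_add_le {c : ℕ} {t ε : ℝ} {g g' : ℝ → Fin c → ℝ}
    (hle : ∀ s ∈ Set.Icc 0 t, ∀ i, g s i + ε ≤ g' s i) (s : ℝ) {z : Fin c → ℝ} (hz : 0 ≤ z) :
    flowValue t g s z ≤ ENNReal.ofReal (Real.exp (-(ε * ∑ i, z i))) * flowValue t g' s z := by
  by_cases hs : s ∈ Set.Icc 0 t
  · have hdot : g s ⬝ᵥ z + ε * ∑ i, z i ≤ g' s ⬝ᵥ z := by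
      simp only [dotProduct, Finset.mul_sum, ← Finset.sum_add_distrib, ← add_mul]
      exact Finset.sum_le_sum fun i _ => mul_le_mul_of_nonneg_right (hle s hs i) (hz i)
    rw [flowValue_of_mem hs, flowValue_of_mem hs, ← ENNReal.ofReal_mul (Real.exp_pos _).le,
      ← Real.exp_add]
    gcongr
    linarith
  · simp [flowValue, hs]

/-- The value `φ` takes at the position after `n` renewals if this is where the walk is at time
`t`, and `0` otherwise. -/
noncomputable def sojournValue {c : ℕ} {Ω : Type*} (A : Matrix (Fin c) (Fin c) ℝ) (x₀ : Fin c → ℝ)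
    (τ : ℕ → Ω → ℝ) (J : ℕ → Ω → Fin c) (t : ℝ) (φ : (Fin c → ℝ) → ENNReal) (n : ℕ) (ω : Ω) :
    ENNReal :=
  (Set.Ico (renewalTime τ n ω) (renewalTime τ (n + 1) ω)).indicator
    (fun _ => φ (renewalPosition A x₀ J n ω)) t

/-- The conditional expectation of `exp (g 0 ⬝ᵥ W t)` given the first `n` renewals, on the event
that they happen before time `t`. -/
noncomputable def remainingValue {c : ℕ} {Ω : Type*} (A : Matrix (Fin c) (Fin c) ℝ)
    (x₀ : Fin c → ℝ) (τ : ℕ → Ω → ℝ) (J : ℕ → Ω → Fin c) (t : ℝ) (g : ℝ → Fin c → ℝ) (n : ℕ)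
    (ω : Ω) : ENNReal :=
  flowValue t g (t - renewalTime τ n ω) (renewalPosition A x₀ J n ω)

theorem tsum_sojournValue {c : ℕ} {Ω : Type*} {A : Matrix (Fin c) (Fin c) ℝ} {x₀ : Fin c → ℝ}
    {τ : ℕ → Ω → ℝ} {J : ℕ → Ω → Fin c} {ω : Ω} (hmono : Monotone fun n => renewalTime τ n ω)
    {t : ℝ} {n : ℕ} (hn : t ∈ Set.Ico (renewalTime τ n ω) (renewalTime τ (n + 1) ω))
    (φ : (Fin c → ℝ) → ENNReal) :
    ∑' m, sojournValue A x₀ τ J t φ m ω = φ (renewalPosition A x₀ J n ω) := by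
  have hother (m : ℕ) (hm : m ≠ n) : sojournValue A x₀ τ J t φ m ω = 0 :=
    Set.indicator_of_notMem (fun hmem =>
      Set.disjoint_left.1 (hmono.pairwise_disjoint_on_Ico_succ hm) hmem hn) _
  exact (tsum_eq_single n hother).trans (Set.indicator_of_mem hn _)

namespace IsRenewalSequence

variable {c : ℕ} {Ω : Type*} [MeasurableSpace Ω] {A : Matrix (Fin c) (Fin c) ℝ}
  {x₀ : Fin c → ℝ} {τ : ℕ → Ω → ℝ} {J : ℕ → Ω → Fin c} {P : Measure Ω} {t : ℝ}
  {g : ℝ → Fin c → ℝ}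

theorem ae_strictMono_renewalTime [SFinite P] (h : IsRenewalSequence A x₀ τ J P)
    (hA : IsGrowing A x₀) : ∀ᵐ ω ∂P, StrictMono fun n => renewalTime τ n ω := by
  filter_upwards [h.ae_waiting_pos hA] with ω hω
  exact strictMono_nat_of_lt_succ fun n => by
    rw [renewalTime_succ]
    exact lt_add_of_pos_right _ (hω n)

theorem aemeasurable_sojournValue (h : IsRenewalSequence A x₀ τ J P) (t : ℝ)
    {φ : (Fin c → ℝ) → ENNReal} (hφ : Measurable φ) (n : ℕ) :
    AEMeasurable (sojournValue A x₀ τ J t φ n) P :=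
  ((hφ.comp_aemeasurable (h.aemeasurable_renewalPosition n)).indicator₀
    ((nullMeasurableSet_le (h.aemeasurable_renewalTime n) aemeasurable_const).inter
      (nullMeasurableSet_lt aemeasurable_const (h.aemeasurable_renewalTime (n + 1))))).congr
    (ae_of_all _ fun _ => rfl)

theorem aemeasurable_remainingValue (h : IsRenewalSequence A x₀ τ J P)
    (hg : IsCharacteristicFlow A t g) (n : ℕ) :
    AEMeasurable (remainingValue A x₀ τ J t g n) P :=
  hg.measurable_flowValue.comp_aemeasurable
    (f := fun ω => (t - renewalTime τ n ω, renewalPosition A x₀ J n ω))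
    (((h.aemeasurable_renewalTime n).const_sub t).prodMk (h.aemeasurable_renewalPosition n))

theorem lintegral_sojournValue_add_remainingValue [SFinite P] (h : IsRenewalSequence A x₀ τ J P)
    (hA : IsGrowing A x₀) (hg : IsCharacteristicFlow A t g) (n : ℕ) :
    ∫⁻ ω, sojournValue A x₀ τ J t (fun z => ENNReal.ofReal (Real.exp (g 0 ⬝ᵥ z))) n ω ∂P
        + ∫⁻ ω, remainingValue A x₀ τ J t g (n + 1) ω ∂P
      = ∫⁻ ω, remainingValue A x₀ τ J t g n ω ∂P := by
  have hmeas := hg.measurable_sojourn_add_flowValue.comp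
    (f := fun q : (ℝ × (Fin c → ℝ)) × (ℝ × Fin c) => ((t - q.1.1, q.1.2), q.2)) (by fun_prop)
  have hnext := h.lintegral_next_renewal n hmeas
  simp only [Function.comp_apply] at hnext
  rw [← lintegral_add_right' _ (h.aemeasurable_remainingValue hg (n + 1))]
  refine (lintegral_congr fun ω => ?_).trans (hnext.trans (lintegral_congr_ae ?_))
  · simp only [sojournValue, remainingValue, Set.indicator, Set.mem_Ico, renewalTime_succ,
      renewalPosition_succ, sub_nonneg, sub_lt_iff_lt_add', sub_sub]
  · filter_upwards [h.ae_strictMono_renewalTime hA] with ω hω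
    refine hg.lintegral_renewalKernel_flowValue (hA.renewalPosition_nonneg n ω)
      (hA.sum_renewalPosition_pos n ω) (sub_le_self t ?_)
    simpa only [renewalTime_zero] using hω.monotone n.zero_le

theorem sum_lintegral_sojournValue_add_remainingValue [IsProbabilityMeasure P]
    (h : IsRenewalSequence A x₀ τ J P) (hA : IsGrowing A x₀) (hg : IsCharacteristicFlow A t g)
    (n : ℕ) :
    ∑ m ∈ Finset.range n,
          ∫⁻ ω, sojournValue A x₀ τ J t (fun z => ENNReal.ofReal (Real.exp (g 0 ⬝ᵥ z))) m ω ∂P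
        + ∫⁻ ω, remainingValue A x₀ τ J t g n ω ∂P
      = flowValue t g t x₀ := by
  induction n with
  | zero => simp [remainingValue, renewalTime_zero, renewalPosition_zero]
  | succ n ih =>
    rw [Finset.sum_range_succ, add_assoc, h.lintegral_sojournValue_add_remainingValue hA hg n, ih]

theorem tendsto_lintegral_remainingValue [IsProbabilityMeasure P]
    (h : IsRenewalSequence A x₀ τ J P) (hA : IsGrowing A x₀) (hg : IsDominatedFlow A t g) :
    Filter.Tendsto (fun n => ∫⁻ ω, remainingValue A x₀ τ J t g n ω ∂P) Filter.atTop (nhds 0) := by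
  obtain ⟨-, ε, hε, g', hg', hle⟩ := hg
  obtain ⟨δ, hδ, hrow⟩ := hA.exists_pos_le_sum_row
  have hbound (n : ℕ) : ∫⁻ ω, remainingValue A x₀ τ J t g n ω ∂P
      ≤ ENNReal.ofReal (Real.exp (-(ε * δ)) ^ n) * flowValue t g' t x₀ := by
    rw [← h.sum_lintegral_sojournValue_add_remainingValue hA hg' n]
    refine le_trans ?_ (mul_le_mul_right le_add_self _)
    rw [← lintegral_const_mul' _ _ ENNReal.ofReal_ne_top]
    refine lintegral_mono fun ω => (flowValue_le_of_add_le hle _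
      (hA.renewalPosition_nonneg n ω)).trans ?_
    have hsum := le_sum_renewalPosition (x₀ := x₀) (J := J) hrow n ω
    rw [← Real.exp_nat_mul, remainingValue]
    gcongr
    nlinarith [hA.sum_start_pos]
  refine tendsto_of_tendsto_of_tendsto_of_le_of_le tendsto_const_nhds ?_ (fun _ => zero_le) hbound
  have hpow := ENNReal.tendsto_ofReal (tendsto_pow_atTop_nhds_zero_of_lt_one
    (Real.exp_pos (-(ε * δ))).le (Real.exp_lt_one_iff.2 (neg_neg_of_pos (mul_pos hε hδ))))
  simpa using ENNReal.Tendsto.mul_const (b := flowValue t g' t x₀) hpow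
    (.inr (by unfold flowValue Set.indicator; split_ifs <;> simp))

theorem tsum_lintegral_sojournValue [IsProbabilityMeasure P] (h : IsRenewalSequence A x₀ τ J P)
    (hA : IsGrowing A x₀) (hg : IsDominatedFlow A t g) :
    ∑' n, ∫⁻ ω, sojournValue A x₀ τ J t (fun z => ENNReal.ofReal (Real.exp (g 0 ⬝ᵥ z))) n ω ∂P
      = flowValue t g t x₀ := by
  have hlim := (ENNReal.tendsto_nat_tsum fun n => ∫⁻ ω, sojournValue A x₀ τ J t
    (fun z => ENNReal.ofReal (Real.exp (g 0 ⬝ᵥ z))) n ω ∂P).add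
      (h.tendsto_lintegral_remainingValue hA hg)
  simp only [h.sum_lintegral_sojournValue_add_remainingValue hA hg.1, add_zero] at hlim
  exact tendsto_nhds_unique hlim tendsto_const_nhds

theorem ae_exists_lt_renewalTime [IsProbabilityMeasure P] (h : IsRenewalSequence A x₀ τ J P)
    (hA : IsGrowing A x₀) (hzero : IsDominatedFlow A t 0) :
    ∀ᵐ ω ∂P, ∃ n, t < renewalTime τ n ω := by
  have hle (n : ℕ) : P {ω | ¬ ∃ n, t < renewalTime τ n ω}
      ≤ ∫⁻ ω, remainingValue A x₀ τ J t 0 n ω ∂P := by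
    refine le_trans (measure_mono_ae ?_) ((one_mul _).symm.trans_le <|
      mul_meas_ge_le_lintegral₀ (h.aemeasurable_remainingValue hzero.1 n) 1)
    filter_upwards [h.ae_strictMono_renewalTime hA] with ω hmono hω
    have hnonneg : 0 ≤ renewalTime τ n ω := by
      simpa only [renewalTime_zero] using hmono.monotone n.zero_le
    have hle : renewalTime τ n ω ≤ t := not_lt.1 fun hlt => hω ⟨n, hlt⟩
    have hmem : t - renewalTime τ n ω ∈ Set.Icc 0 t := ⟨sub_nonneg.2 hle, sub_le_self t hnonneg⟩
    change 1 ≤ remainingValue A x₀ τ J t 0 n ω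
    simp [remainingValue, flowValue_of_mem hmem]
  exact nonpos_iff_eq_zero.1 (ge_of_tendsto' (h.tendsto_lintegral_remainingValue hA hzero) hle)

theorem ae_exists_mem_Ico_renewalTime [IsProbabilityMeasure P] (h : IsRenewalSequence A x₀ τ J P)
    (hA : IsGrowing A x₀) (ht : 0 ≤ t) (hzero : IsDominatedFlow A t 0) :
    ∀ᵐ ω ∂P, ∃ n, t ∈ Set.Ico (renewalTime τ n ω) (renewalTime τ (n + 1) ω) := by
  filter_upwards [h.ae_exists_lt_renewalTime hA hzero] with ω hω
  obtain ⟨n, hn⟩ : ∃ n, Nat.find hω = n + 1 := Nat.exists_eq_succ_of_ne_zero fun h0 => by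
    have := Nat.find_spec hω
    rw [h0, renewalTime_zero] at this
    exact this.not_ge ht
  exact ⟨n, not_lt.1 (Nat.find_min hω (by omega)), hn ▸ Nat.find_spec hω⟩

end IsRenewalSequence

namespace IsContinuumPolyaWalk

variable {c : ℕ} {Ω : Type*} [MeasurableSpace Ω] {A : Matrix (Fin c) (Fin c) ℝ}
  {x₀ : Fin c → ℝ} {W : ℝ → Ω → Fin c → ℝ} {P : Measure Ω} [IsProbabilityMeasure P] {t : ℝ}
  {g : ℝ → Fin c → ℝ}

theorem ae_eq_tsum_sojournValue (hW : IsContinuumPolyaWalk A x₀ W P) (hA : IsGrowing A x₀)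
    (ht : 0 ≤ t) (hzero : IsDominatedFlow A t 0) :
    ∃ τ J, IsRenewalSequence A x₀ τ J P ∧ ∀ φ : (Fin c → ℝ) → ENNReal,
      (fun ω => φ (W t ω)) =ᵐ[P] fun ω => ∑' n, sojournValue A x₀ τ J t φ n ω := by
  obtain ⟨τ, J, hseq, hpath⟩ := hW
  have h : IsRenewalSequence A x₀ τ J P := hseq
  refine ⟨τ, J, h, fun φ => ?_⟩
  filter_upwards [hpath, h.ae_strictMono_renewalTime hA,
    h.ae_exists_mem_Ico_renewalTime hA ht hzero] with ω hω hmono ⟨n, hn⟩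
  rw [tsum_sojournValue hmono.monotone hn, hω n t hn.1 hn.2]
  rfl

theorem integrable_and_integral_exp_dotProduct (hW : IsContinuumPolyaWalk A x₀ W P)
    (hA : IsGrowing A x₀) (ht : 0 ≤ t) (hzero : IsDominatedFlow A t 0)
    (hg : IsDominatedFlow A t g) :
    Integrable (fun ω => Real.exp (g 0 ⬝ᵥ W t ω)) P ∧
      ∫ ω, Real.exp (g 0 ⬝ᵥ W t ω) ∂P = Real.exp (g t ⬝ᵥ x₀) := by
  obtain ⟨τ, J, h, heq⟩ := hW.ae_eq_tsum_sojournValue hA ht hzero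
  let φ (z : Fin c → ℝ) : ENNReal := ENNReal.ofReal (Real.exp (g 0 ⬝ᵥ z))
  have hφ : Measurable φ := by
    unfold φ dotProduct
    fun_prop
  have hmeas := h.aemeasurable_sojournValue t hφ
  have haem : AEMeasurable (fun ω => φ (W t ω)) P := (AEMeasurable.tsum hmeas).congr (heq φ).symm
  have hlint : ∫⁻ ω, φ (W t ω) ∂P = ENNReal.ofReal (Real.exp (g t ⬝ᵥ x₀)) := by
    rw [lintegral_congr_ae (heq φ), lintegral_tsum hmeas, h.tsum_lintegral_sojournValue hA hg,
      flowValue_of_mem (Set.right_mem_Icc.2 ht)]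
  have hnonneg : 0 ≤ᵐ[P] fun ω => Real.exp (g 0 ⬝ᵥ W t ω) :=
    ae_of_all _ fun ω => (Real.exp_pos _).le
  have hstrong : AEStronglyMeasurable (fun ω => Real.exp (g 0 ⬝ᵥ W t ω)) P := by
    simpa only [φ, ENNReal.toReal_ofReal (Real.exp_pos _).le]
      using haem.ennreal_toReal.aestronglyMeasurable
  refine ⟨⟨hstrong, ?_⟩, ?_⟩
  · rw [hasFiniteIntegral_iff_ofReal hnonneg, hlint]
    exact ENNReal.ofReal_lt_top
  · rw [integral_eq_lintegral_of_nonneg_ae hnonneg hstrong, hlint,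
      ENNReal.toReal_ofReal (Real.exp_pos _).le]

end IsContinuumPolyaWalk

/-- The second bracket `e^{-δv} - 1 + e^{-δs}` of the joint moment generating function. -/
noncomputable def secondBracket (δ v s : ℝ) : ℝ :=
  Real.exp (-δ * v) - 1 + Real.exp (-δ * s)

/-- The first bracket `e^{-αu} - e^{-αv} + (e^{-δv} - 1 + e^{-δs})^{α/δ}` of the joint moment
generating function. -/
noncomputable def firstBracket (α δ u v s : ℝ) : ℝ :=
  Real.exp (-α * u) - Real.exp (-α * v) + secondBracket δ v s ^ (α / δ)

/-- The pairs `(u, v)` for which both brackets are positive at time `s`. -/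
def mgfDomain (α δ s : ℝ) : Set (ℝ × ℝ) :=
  {p | 0 < secondBracket δ p.2 s ∧ 0 < firstBracket α δ p.1 p.2 s}

/-- The characteristic flow of `!![α, δ - α; 0, δ]` that starts at `(u, v)`: both brackets of the
moment generating function, in logarithmic scale. -/
noncomputable def triangularFlow (α δ u v s : ℝ) : Fin 2 → ℝ :=
  ![-s - Real.log (firstBracket α δ u v s) / α, -s - Real.log (secondBracket δ v s) / δ]

section Triangular

variable {α δ : ℝ}

theorem secondBracket_antitone (hδ : 0 ≤ δ) (v : ℝ) : Antitone (secondBracket δ v) :=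
  fun s s' hs => by
    unfold secondBracket
    gcongr _ + Real.exp ?_
    nlinarith

theorem mgfDomain_antitone (hα : 0 ≤ α) (hδ : 0 ≤ δ) : Antitone (mgfDomain α δ) :=
  fun s s' hs p hp => by
    have hle := secondBracket_antitone hδ p.2 hs
    have hpow := Real.rpow_le_rpow hp.1.le hle (div_nonneg hα hδ)
    exact ⟨hp.1.trans_le hle, hp.2.trans_le (add_le_add_right hpow _)⟩

theorem isOpen_mgfDomain (hα : 0 ≤ α) (hδ : 0 ≤ δ) (s : ℝ) : IsOpen (mgfDomain α δ s) := by
  have hpow : Continuous fun x : ℝ => x ^ (α / δ) :=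
    Real.continuous_rpow_const (div_nonneg hα hδ)
  have hsecond : Continuous fun p : ℝ × ℝ => secondBracket δ p.2 s := by
    unfold secondBracket
    fun_prop
  have hfirst : Continuous fun p : ℝ × ℝ => firstBracket α δ p.1 p.2 s :=
    .add (by fun_prop) (hpow.comp hsecond)
  exact (isOpen_lt continuous_const hsecond).inter (isOpen_lt continuous_const hfirst)

theorem secondBracket_zero (δ s : ℝ) : secondBracket δ 0 s = Real.exp (-δ * s) := by
  simp [secondBracket]

theorem firstBracket_zero (α : ℝ) (hδ : δ ≠ 0) (s : ℝ) :
    firstBracket α δ 0 0 s = Real.exp (-α * s) := by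
  rw [firstBracket, secondBracket_zero, ← Real.exp_mul, sub_self, zero_add]
  congr 1
  field_simp

theorem zero_mem_mgfDomain (α : ℝ) (hδ : δ ≠ 0) (s : ℝ) : (0, 0) ∈ mgfDomain α δ s :=
  ⟨secondBracket_zero δ s ▸ Real.exp_pos _, firstBracket_zero α hδ s ▸ Real.exp_pos _⟩

theorem triangularFlow_zero_zero (hα : α ≠ 0) (hδ : δ ≠ 0) : triangularFlow α δ 0 0 = 0 := by
  ext s i
  fin_cases i
  · simp [triangularFlow, firstBracket_zero α hδ, hα, neg_div]
  · simp [triangularFlow, secondBracket_zero, hδ, neg_div]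

theorem triangularFlow_apply_zero (hα : α ≠ 0) (hδ : δ ≠ 0) (u v : ℝ) :
    triangularFlow α δ u v 0 = ![u, v] := by
  have hsecond : secondBracket δ v 0 = Real.exp (-δ * v) := by simp [secondBracket]
  have hfirst : firstBracket α δ u v 0 = Real.exp (-α * u) := by
    rw [firstBracket, hsecond, ← Real.exp_mul, show -δ * v * (α / δ) = -α * v by field_simp,
      sub_add_cancel]
  rw [triangularFlow, hsecond, hfirst, Real.log_exp, Real.log_exp]
  simp [hα, hδ, neg_div]

theorem hasDerivAt_secondBracket (δ v s : ℝ) :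
    HasDerivAt (secondBracket δ v) (-δ * Real.exp (-δ * s)) s := by
  refine (((hasDerivAt_id s).const_mul (-δ)).exp.const_add _).congr_deriv ?_
  simp only [id_eq]
  ring

theorem hasDerivAt_firstBracket (α : ℝ) (hδ : δ ≠ 0) (u : ℝ) {v s : ℝ}
    (hpos : 0 < secondBracket δ v s) :
    HasDerivAt (firstBracket α δ u v)
      (-α * Real.exp (-δ * s) * secondBracket δ v s ^ (α / δ - 1)) s := by
  refine (((hasDerivAt_secondBracket δ v s).rpow_const (.inl hpos.ne')).const_add _).congr_deriv ?_
  field_simp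

theorem exp_mulVec_triangularFlow (hα : α ≠ 0) (hδ : δ ≠ 0) {s u v : ℝ}
    (huv : (u, v) ∈ mgfDomain α δ s) :
    (fun i => Real.exp ((!![α, δ - α; 0, δ] *ᵥ triangularFlow α δ u v s) i))
      = ![Real.exp (-δ * s) * secondBracket δ v s ^ (α / δ - 1) / firstBracket α δ u v s,
        Real.exp (-δ * s) / secondBracket δ v s] := by
  obtain ⟨hsecond, hfirst⟩ : 0 < secondBracket δ v s ∧ 0 < firstBracket α δ u v s := huv
  refine funext (Fin.forall_fin_two.2 ⟨?_, ?_⟩) <;>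
    simp only [triangularFlow, Matrix.mulVec, Matrix.vec2_dotProduct, Matrix.of_apply,
      Matrix.cons_val_zero, Matrix.cons_val_one]
  · rw [Real.rpow_def_of_pos hsecond, div_eq_mul_inv (Real.exp _ * _),
      ← Real.exp_log (inv_pos.2 hfirst), Real.log_inv, ← Real.exp_add, ← Real.exp_add]
    congr 1
    field_simp
    ring
  · rw [div_eq_mul_inv (Real.exp _), ← Real.exp_log (inv_pos.2 hsecond), Real.log_inv,
      ← Real.exp_add]
    congr 1
    field_simp
    ring

theorem isCharacteristicFlow_triangularFlow (hα : 0 < α) (hδ : 0 < δ) {t u v : ℝ}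
    (huv : (u, v) ∈ mgfDomain α δ t) :
    IsCharacteristicFlow !![α, δ - α; 0, δ] t (triangularFlow α δ u v) := by
  intro s hs
  have huv_s := mgfDomain_antitone hα.le hδ.le hs.2 huv
  have hexp := congrFun (exp_mulVec_triangularFlow hα.ne' hδ.ne' huv_s)
  obtain ⟨hsecond, hfirst⟩ : 0 < secondBracket δ v s ∧ 0 < firstBracket α δ u v s := huv_s
  refine hasDerivAt_pi.2 (Fin.forall_fin_two.2 ⟨?_, ?_⟩)
  · refine ((hasDerivAt_id s).neg.sub (((hasDerivAt_firstBracket α hδ.ne' u hsecond).log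
      hfirst.ne').div_const α)).congr_deriv ?_
    rw [hexp, Matrix.cons_val_zero]
    field_simp
    ring
  · refine ((hasDerivAt_id s).neg.sub (((hasDerivAt_secondBracket δ v s).log
      hsecond.ne').div_const δ)).congr_deriv ?_
    rw [hexp, Matrix.cons_val_one, Matrix.cons_val_zero]
    field_simp
    ring

theorem secondBracket_add_le {ε s : ℝ} (hδ : 0 ≤ δ) (hε : 0 ≤ ε) (hs : 0 ≤ s) (v : ℝ) :
    secondBracket δ (v + ε) s ≤ Real.exp (-δ * ε) * secondBracket δ v s := by
  have hshift : Real.exp (-δ * ε) ≤ 1 := Real.exp_le_one_iff.2 (by nlinarith)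
  have hdecay : Real.exp (-δ * s) ≤ 1 := Real.exp_le_one_iff.2 (by nlinarith)
  rw [secondBracket, secondBracket, mul_add (-δ), Real.exp_add]
  nlinarith

theorem firstBracket_add_le {ε s v : ℝ} (hα : 0 ≤ α) (hδ : 0 < δ) (hε : 0 ≤ ε) (hs : 0 ≤ s)
    (u : ℝ) (hv : 0 ≤ secondBracket δ (v + ε) s) :
    firstBracket α δ (u + ε) (v + ε) s ≤ Real.exp (-α * ε) * firstBracket α δ u v s := by
  have hsecond := secondBracket_add_le hδ.le hε hs v
  have hv' : 0 ≤ secondBracket δ v s :=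
    nonneg_of_mul_nonneg_right (hv.trans hsecond) (Real.exp_pos _)
  have hpow : secondBracket δ (v + ε) s ^ (α / δ)
      ≤ Real.exp (-α * ε) * secondBracket δ v s ^ (α / δ) := calc
    _ ≤ (Real.exp (-δ * ε) * secondBracket δ v s) ^ (α / δ) := by gcongr
    _ = _ := by
      rw [Real.mul_rpow (Real.exp_pos _).le hv', ← Real.exp_mul]
      congr 2
      field_simp
  rw [firstBracket, firstBracket, mul_add (-α), mul_add (-α), Real.exp_add, Real.exp_add]
  linarith

theorem triangularFlow_add_le (hα : 0 < α) (hδ : 0 < δ) {ε s u v : ℝ} (hε : 0 ≤ ε) (hs : 0 ≤ s)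
    (huv : (u, v) ∈ mgfDomain α δ s) (huv' : (u + ε, v + ε) ∈ mgfDomain α δ s) :
    ∀ i, triangularFlow α δ u v s i + ε ≤ triangularFlow α δ (u + ε) (v + ε) s i := by
  have hX := log_add_le_of_le_exp_mul huv.2 huv'.2 hα
    (firstBracket_add_le hα.le hδ hε hs u huv'.1.le)
  have hY := log_add_le_of_le_exp_mul huv.1 huv'.1 hδ (secondBracket_add_le hδ.le hε hs v)
  simp only [neg_div] at hX hY
  refine Fin.forall_fin_two.2 ⟨?_, ?_⟩ <;>
    simp only [triangularFlow, Matrix.cons_val_zero, Matrix.cons_val_one] <;> linarith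

theorem isDominatedFlow_triangularFlow (hα : 0 < α) (hδ : 0 < δ) {t u v : ℝ}
    (huv : (u, v) ∈ mgfDomain α δ t) :
    IsDominatedFlow !![α, δ - α; 0, δ] t (triangularFlow α δ u v) := by
  have hshift : ∀ᶠ ε in nhdsWithin (0 : ℝ) (Set.Ioi 0), (u + ε, v + ε) ∈ mgfDomain α δ t := by
    have hcont : Continuous fun ε : ℝ => (u + ε, v + ε) := by fun_prop
    refine nhdsWithin_le_nhds (hcont.continuousAt.eventually_mem ?_)
    simpa using (isOpen_mgfDomain hα.le hδ.le t).mem_nhds huv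
  obtain ⟨ε, huv', hε⟩ := (hshift.and self_mem_nhdsWithin).exists
  have hε : 0 < ε := hε
  exact ⟨isCharacteristicFlow_triangularFlow hα hδ huv, ε, hε, triangularFlow α δ (u + ε) (v + ε),
    isCharacteristicFlow_triangularFlow hα hδ huv', fun s hs =>
      triangularFlow_add_le hα hδ hε.le hs.1 (mgfDomain_antitone hα.le hδ.le hs.2 huv)
        (mgfDomain_antitone hα.le hδ.le hs.2 huv')⟩

theorem isDominatedFlow_zero (hα : 0 < α) (hδ : 0 < δ) (t : ℝ) :
    IsDominatedFlow !![α, δ - α; 0, δ] t 0 := by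
  rw [← triangularFlow_zero_zero hα.ne' hδ.ne']
  exact isDominatedFlow_triangularFlow hα hδ (zero_mem_mgfDomain α hδ.ne' t)

theorem exp_triangularFlow_dotProduct {t u v : ℝ} (huv : (u, v) ∈ mgfDomain α δ t) (x₀ y₀ : ℝ) :
    Real.exp (triangularFlow α δ u v t ⬝ᵥ ![x₀, y₀])
      = Real.exp (-x₀ * t) * firstBracket α δ u v t ^ (-x₀ / α)
        * (Real.exp (-y₀ * t) * secondBracket δ v t ^ (-y₀ / δ)) := by
  obtain ⟨hsecond, hfirst⟩ := huv
  rw [Real.rpow_def_of_pos hsecond, Real.rpow_def_of_pos hfirst, ← Real.exp_add, ← Real.exp_add,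
    ← Real.exp_add, triangularFlow, Matrix.vec2_dotProduct']
  congr 1
  ring

theorem isGrowing_triangular {x₀ y₀ : ℝ} (hα : 0 ≤ α) (hαδ : α ≤ δ) (hδ : 0 < δ) (hx₀ : 0 ≤ x₀)
    (hy₀ : 0 ≤ y₀) (hxy₀ : 0 < x₀ + y₀) : IsGrowing !![α, δ - α; 0, δ] ![x₀, y₀] where
  row_nonneg i := by
    refine fun j => ?_
    fin_cases i <;> fin_cases j <;> simp [hα, hαδ, hδ.le]
  sum_row_pos i := by fin_cases i <;> simpa
  start_nonneg i := by fin_cases i <;> simpa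
  sum_start_pos := by simpa

end Triangular

/-- The derivative at `θ` of `θ ↦ triangularFlow α δ (i * θ) (j * θ) t`. -/
noncomputable def triangularFlowSlope (α δ i j t θ : ℝ) : Fin 2 → ℝ :=
  ![(i * Real.exp (-α * (i * θ)) - j * Real.exp (-α * (j * θ))
      + j * Real.exp (-δ * (j * θ)) * secondBracket δ (j * θ) t ^ (α / δ - 1))
        / firstBracket α δ (i * θ) (j * θ) t,
    j * Real.exp (-δ * (j * θ)) / secondBracket δ (j * θ) t]

section Moments

variable {α δ : ℝ}

theorem hasDerivAt_secondBracket_mul (δ j t θ : ℝ) :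
    HasDerivAt (fun θ => secondBracket δ (j * θ) t) (-δ * j * Real.exp (-δ * (j * θ))) θ :=
  ((hasDerivAt_exp_mul_mul (-δ) j θ).sub_const 1).add_const _

theorem hasDerivAt_firstBracket_mul (α : ℝ) (hδ : δ ≠ 0) (i : ℝ) {j t θ : ℝ}
    (hpos : 0 < secondBracket δ (j * θ) t) :
    HasDerivAt (fun θ => firstBracket α δ (i * θ) (j * θ) t)
      (-α * (i * Real.exp (-α * (i * θ)) - j * Real.exp (-α * (j * θ))
        + j * Real.exp (-δ * (j * θ)) * secondBracket δ (j * θ) t ^ (α / δ - 1))) θ := by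
  refine (((hasDerivAt_exp_mul_mul (-α) i θ).sub (hasDerivAt_exp_mul_mul (-α) j θ)).add
    ((hasDerivAt_secondBracket_mul δ j t θ).rpow_const (.inl hpos.ne'))).congr_deriv ?_
  field_simp
  ring

theorem hasDerivAt_triangularFlow_mul (hα : α ≠ 0) (hδ : δ ≠ 0) {i j t θ : ℝ}
    (hmem : (i * θ, j * θ) ∈ mgfDomain α δ t) :
    HasDerivAt (fun θ => triangularFlow α δ (i * θ) (j * θ) t)
      (triangularFlowSlope α δ i j t θ) θ := by
  obtain ⟨hsecond, hfirst⟩ := hmem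
  refine hasDerivAt_pi.2 (Fin.forall_fin_two.2 ⟨?_, ?_⟩)
  · refine ((((hasDerivAt_firstBracket_mul α hδ i hsecond).log hfirst.ne').div_const α).const_sub
      (-t)).congr_deriv ?_
    simp only [triangularFlowSlope, Matrix.cons_val_zero]
    field_simp
  · refine ((((hasDerivAt_secondBracket_mul δ j t θ).log hsecond.ne').div_const δ).const_sub
      (-t)).congr_deriv ?_
    simp only [triangularFlowSlope, Matrix.cons_val_one, Matrix.cons_val_zero]
    field_simp

theorem secondBracket_zero_rpow_sub_one (α : ℝ) (hδ : δ ≠ 0) (t : ℝ) :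
    secondBracket δ 0 t ^ (α / δ - 1) = Real.exp (δ * t) / Real.exp (α * t) := by
  rw [secondBracket_zero, ← Real.exp_mul, ← Real.exp_sub]
  congr 1
  field_simp
  ring

theorem triangularFlowSlope_zero (α : ℝ) (hδ : δ ≠ 0) (i j t : ℝ) :
    triangularFlowSlope α δ i j t 0
      = ![(i - j) * Real.exp (α * t) + j * Real.exp (δ * t), j * Real.exp (δ * t)] := by
  simp only [triangularFlowSlope, mul_zero, Real.exp_zero, mul_one]
  rw [secondBracket_zero_rpow_sub_one α hδ, firstBracket_zero α hδ, secondBracket_zero]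
  simp only [neg_mul, Real.exp_neg, div_inv_eq_mul]
  congr 1
  field_simp

theorem hasDerivAt_triangularFlowSlope_zero (α : ℝ) (hδ : δ ≠ 0) (i j t : ℝ) :
    HasDerivAt (triangularFlowSlope α δ i j t)
      ![α * ((i - j) * Real.exp (α * t) + j * Real.exp (δ * t)) ^ 2
          - α * (i ^ 2 - j ^ 2) * Real.exp (α * t)
          - (α - δ) * j ^ 2 * Real.exp (δ * t) ^ 2 - δ * j ^ 2 * Real.exp (δ * t),
        δ * j ^ 2 * (Real.exp (δ * t) ^ 2 - Real.exp (δ * t))] 0 := by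
  obtain ⟨hsecond, hfirst⟩ : (i * 0, j * 0) ∈ mgfDomain α δ t := by
    simpa using zero_mem_mgfDomain α hδ t
  have hpow := secondBracket_zero_rpow_sub_one α hδ t
  have hpow' : secondBracket δ 0 t ^ (α / δ - 1 - 1)
      = Real.exp (δ * t) ^ 2 / Real.exp (α * t) := by
    rw [Real.rpow_sub_one (by simpa using hsecond.ne'), hpow, secondBracket_zero, neg_mul,
      Real.exp_neg]
    field_simp
  have hD := hasDerivAt_secondBracket_mul δ j t 0
  have hB := hasDerivAt_firstBracket_mul α hδ i hsecond
  refine hasDerivAt_pi.2 (Fin.forall_fin_two.2 ⟨?_, ?_⟩)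
  · refine (((((hasDerivAt_exp_mul_mul (-α) i 0).const_mul i).sub
      ((hasDerivAt_exp_mul_mul (-α) j 0).const_mul j)).add
      (((hasDerivAt_exp_mul_mul (-δ) j 0).const_mul j).mul
        (hD.rpow_const (.inl hsecond.ne')))).div hB hfirst.ne').congr_deriv ?_
    simp only [Pi.add_apply, Pi.sub_apply, Pi.mul_apply, mul_zero, Real.exp_zero, mul_one, hpow,
      hpow', firstBracket_zero α hδ, neg_mul, Real.exp_neg, Matrix.cons_val_zero]
    field_simp
    ring
  · refine ((((hasDerivAt_exp_mul_mul (-δ) j 0).const_mul j).div hD hsecond.ne')).congr_deriv ?_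
    simp only [mul_zero, Real.exp_zero, mul_one, secondBracket_zero, neg_mul, Real.exp_neg,
      Matrix.cons_val_one, Matrix.cons_val_zero]
    field_simp
    ring

end Moments

namespace IsContinuumPolyaWalk

variable {Ω : Type*} [MeasurableSpace Ω] {P : Measure Ω} [IsProbabilityMeasure P]

theorem integrable_exp_and_cgf_eq {c : ℕ} {A : Matrix (Fin c) (Fin c) ℝ} {x₀ : Fin c → ℝ}
    {W : ℝ → Ω → Fin c → ℝ} (hW : IsContinuumPolyaWalk A x₀ W P) (hA : IsGrowing A x₀) {t : ℝ}
    (ht : 0 ≤ t) (hzero : IsDominatedFlow A t 0) {g : ℝ → Fin c → ℝ} (hg : IsDominatedFlow A t g)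
    {w : Fin c → ℝ} {θ : ℝ} (hstart : g 0 = θ • w) :
    Integrable (fun ω => Real.exp (θ * (w ⬝ᵥ W t ω))) P ∧
      cgf (fun ω => w ⬝ᵥ W t ω) P θ = g t ⬝ᵥ x₀ := by
  obtain ⟨hint, heq⟩ := hW.integrable_and_integral_exp_dotProduct hA ht hzero hg
  simp only [hstart, smul_dotProduct, smul_eq_mul] at hint heq
  exact ⟨hint, by rw [cgf, mgf, heq, Real.log_exp]⟩

variable {α δ x₀ y₀ t : ℝ} {W : ℝ → Ω → Fin 2 → ℝ}

theorem moments_dotProduct_of_triangular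
    (hW : IsContinuumPolyaWalk !![α, δ - α; 0, δ] ![x₀, y₀] W P)
    (hA : IsGrowing !![α, δ - α; 0, δ] ![x₀, y₀]) (hα : 0 < α) (hδ : 0 < δ) (ht : 0 ≤ t)
    (i j : ℝ) :
    MemLp (fun ω => ![i, j] ⬝ᵥ W t ω) 2 P ∧
      ∫ ω, ![i, j] ⬝ᵥ W t ω ∂P
        = ((i - j) * Real.exp (α * t) + j * Real.exp (δ * t)) * x₀ + j * Real.exp (δ * t) * y₀ ∧
      ∫ ω, (![i, j] ⬝ᵥ W t ω) ^ 2 ∂P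
        = (α * ((i - j) * Real.exp (α * t) + j * Real.exp (δ * t)) ^ 2
            - α * (i ^ 2 - j ^ 2) * Real.exp (α * t)
            - (α - δ) * j ^ 2 * Real.exp (δ * t) ^ 2 - δ * j ^ 2 * Real.exp (δ * t)) * x₀
          + δ * j ^ 2 * (Real.exp (δ * t) ^ 2 - Real.exp (δ * t)) * y₀
          + (((i - j) * Real.exp (α * t) + j * Real.exp (δ * t)) * x₀
            + j * Real.exp (δ * t) * y₀) ^ 2 := by
  have hmem : ∀ᶠ θ in nhds (0 : ℝ), (i * θ, j * θ) ∈ mgfDomain α δ t := by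
    have hcont : Continuous fun θ : ℝ => (i * θ, j * θ) := by fun_prop
    refine hcont.continuousAt.eventually_mem ((isOpen_mgfDomain hα.le hδ.le t).mem_nhds ?_)
    simpa using zero_mem_mgfDomain α hδ.ne' t
  have hcgf {θ : ℝ} (hθ : (i * θ, j * θ) ∈ mgfDomain α δ t) :=
    hW.integrable_exp_and_cgf_eq hA ht (isDominatedFlow_zero hα hδ t)
      (isDominatedFlow_triangularFlow hα hδ hθ) (w := ![i, j]) (θ := θ)
      (by simp [triangularFlow_apply_zero hα.ne' hδ.ne', mul_comm])
  have hdot {f : ℝ → Fin 2 → ℝ} {f' : Fin 2 → ℝ} {θ : ℝ} (hf : HasDerivAt f f' θ) :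
      HasDerivAt (fun θ => f θ ⬝ᵥ ![x₀, y₀]) (f' ⬝ᵥ ![x₀, y₀]) θ :=
    HasDerivAt.fun_sum fun i _ => (hasDerivAt_pi.1 hf i).mul_const _
  have hmoments := moments_of_hasDerivAt_cgf (hmem.mono fun θ hθ => (hcgf hθ).1)
    (hmem.mono fun θ hθ => (hcgf hθ).2)
    (hmem.mono fun θ hθ => hdot (hasDerivAt_triangularFlow_mul hα.ne' hδ.ne' hθ))
    (hdot (hasDerivAt_triangularFlowSlope_zero α hδ.ne' i j t))
  simpa only [triangularFlowSlope_zero α hδ.ne', Matrix.vec2_dotProduct'] using hmoments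

end IsContinuumPolyaWalk

theorem theorem3 {Ω : Type*} [MeasurableSpace Ω] (P : Measure Ω) [IsProbabilityMeasure P]
    (α δ x₀ y₀ : ℝ) (hα : 0 < α) (hαδ : α < δ)
    (hx₀ : 0 ≤ x₀) (hy₀ : 0 ≤ y₀) (hxy₀ : 0 < x₀ + y₀)
    (W : ℝ → Ω → Fin 2 → ℝ)
    (hW : IsContinuumPolyaWalk !![α, δ - α; 0, δ] ![x₀, y₀] W P)
    (t : ℝ) (ht : 0 ≤ t) :
    -- the moment generating function
    (∀ u v : ℝ,
      0 < Real.exp (-δ * v) - 1 + Real.exp (-δ * t) →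
      0 < Real.exp (-α * u) - Real.exp (-α * v)
        + (Real.exp (-δ * v) - 1 + Real.exp (-δ * t)) ^ (α / δ) →
      Integrable (fun ω => Real.exp (u * W t ω 0 + v * W t ω 1)) P ∧
      ∫ ω, Real.exp (u * W t ω 0 + v * W t ω 1) ∂P
        = Real.exp (-x₀ * t)
          * (Real.exp (-α * u) - Real.exp (-α * v)
              + (Real.exp (-δ * v) - 1 + Real.exp (-δ * t)) ^ (α / δ)) ^ (-x₀ / α)
          * (Real.exp (-y₀ * t)
            * (Real.exp (-δ * v) - 1 + Real.exp (-δ * t)) ^ (-y₀ / δ))) ∧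
    -- the first and second moments
    (MemLp (fun ω => W t ω 0) 2 P ∧ MemLp (fun ω => W t ω 1) 2 P ∧
      ∫ ω, W t ω 0 ∂P = x₀ * Real.exp (α * t) ∧
      ∫ ω, W t ω 1 ∂P = (x₀ + y₀) * Real.exp (δ * t) - x₀ * Real.exp (α * t) ∧
      ∫ ω, W t ω 0 ^ 2 ∂P
        = x₀ * (α + x₀) * Real.exp (2 * α * t) - α * x₀ * Real.exp (α * t) ∧
      ∫ ω, W t ω 0 * W t ω 1 ∂P
        = x₀ * (α + x₀ + y₀) * Real.exp ((α + δ) * t)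
          - x₀ * (α + x₀) * Real.exp (2 * α * t) ∧
      ∫ ω, W t ω 1 ^ 2 ∂P
        = (x₀ + y₀) * (δ + x₀ + y₀) * Real.exp (2 * δ * t)
          - 2 * x₀ * (α + x₀ + y₀) * Real.exp ((α + δ) * t)
          - δ * (x₀ + y₀) * Real.exp (δ * t)
          + x₀ * (α + x₀) * Real.exp (2 * α * t)
          + α * x₀ * Real.exp (α * t)) := by
  have hδ : 0 < δ := hα.trans hαδ
  have hA := isGrowing_triangular hα.le hαδ.le hδ hx₀ hy₀ hxy₀
  refine ⟨fun u v hsecond hfirst => ?_, ?_⟩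
  · have hmem : (u, v) ∈ mgfDomain α δ t := ⟨hsecond, hfirst⟩
    have hmgf := hW.integrable_and_integral_exp_dotProduct hA ht (isDominatedFlow_zero hα hδ t)
      (isDominatedFlow_triangularFlow hα hδ hmem)
    rw [exp_triangularFlow_dotProduct hmem] at hmgf
    simpa only [triangularFlow_apply_zero hα.ne' hδ.ne', Matrix.vec2_dotProduct, firstBracket,
      secondBracket, Matrix.cons_val_zero, Matrix.cons_val_one] using hmgf
  have hmoments (i j : ℝ) := hW.moments_dotProduct_of_triangular hA hα hδ ht i j
  simp only [Matrix.vec2_dotProduct] at hmoments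
  obtain ⟨hX, hmeanX, hsqX⟩ := by simpa using hmoments 1 0
  obtain ⟨hY, hmeanY, hsqY⟩ := by simpa using hmoments 0 1
  obtain ⟨-, -, hsqXY⟩ := by simpa using hmoments 1 1
  have hXY := integral_mul_eq_half_integral_sq_add_sub hX hY
  rw [hsqXY, hsqX, hsqY] at hXY
  simp only [two_mul, add_mul, Real.exp_add]
  refine ⟨hX, hY, ?_, ?_, ?_, ?_, ?_⟩ <;> linarith
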